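/- **Theorem 1.2.** Let $n\ge 3$, $m\ge 1$, let $\varepsilon_1,\dots,\varepsilon_n\in\{1,-1\}$ and let $g=\sum_i\varepsilon_i\,dx_i^2$ be the pseudo-Euclidean metric on $\mathbb R^n$. Let $F$ be a non-empty smooth $m$-dimensional manifold with a semi-Riemannian metric $g_F$ which is Einstein with constant Ricci curvature $\lambda_F\in\mathbb R$, i.e. $\mathrm{Ric}_{g_F}=\lambda_F\,g_F$. Let $\alpha=(\alpha_1,\dots,\alpha_n)\in\mathbb R^n$ be non-zero, put $\xi=\sum_i\alpha_ix_i$, let $\varphi,f:\mathbb R\to\mathbb R$ be smooth functions with $\varphi$ nowhere zero and $f>0$, and regard $\varphi(\xi)$ and $f(\xi)$ as functions on $\mathbb R^n$. Let $M=(\mathbb R^n,\overline g)\times_f F$ be the warped product, i.e. $\mathbb R^n\times F$ with the metric $\widetilde g=\overline g+f(\xi)^2g_F$, where $\overline g=\varphi(\xi)^{-2}g$. Let $\lambda\in\mathbb R$. (i) If $\sum_{i}\varepsilon_i\alpha_i^2\neq 0$, then $M$ is Einstein with constant Ricci curvature $\lambda$, i.e. $\mathrm{Ric}_{\widetilde g}=\lambda\,\widetilde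 g$, if and only if $\varphi$ and $f$ satisfy on $\mathbb R$ $$\left\{\begin{array}{l} (n-2)f\varphi''-m\varphi f''-2m\varphi'f'=0,\\[2pt] \displaystyle\sum_{k=1}^n\varepsilon_k\alpha_k^2\,\big[f\varphi\varphi''-(n-1)f(\varphi')^2+m\varphi\varphi'f'\big]=\lambda f,\\[2pt] \displaystyle\sum_{k=1}^n\varepsilon_k\alpha_k^2\,\big[-f\varphi^2f''+(n-2)f\varphi\varphi'f'-(m-1)\varphi^2(f')^2\big]=\lambda f^2-\lambda_F. \end{array}\right.$$ (ii) If $\sum_{i}\varepsilon_i\alpha_i^2=0$, then $M$ is Einstein with constant Ricci curvature $\lambda$ if and only if $$(n-2)f\varphi''-m\varphi f''-2m\varphi'f'=0\ \text{ on }\mathbb R\qquad\text{and}\qquad\lambda=\lambda_F=0.$$ -/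

import Mathlib

open scoped Manifold ContDiff

set_option maxSynthPendingDepth 3

noncomputable section

/-! ### Ricci curvature of a metric on a coordinate domain

`G : V → V →L[ℝ] V →L[ℝ] ℝ` is a metric written in coordinates ranging over the finite-dimensional
vector space `V`; vectors of `V` are identified with constant coordinate vector fields. -/

section Coordinates

variable {V : Type*} [NormedAddCommGroup V] [NormedSpace ℝ V]

/-- Christoffel symbols of the first kind:
`Γ(u, v; w) = (1/2) (∂_u G(v, w) + ∂_v G(u, w) - ∂_w G(u, v))`. -/
def christoffelFirst (G : V → V →L[ℝ] V →L[ℝ] ℝ) (y : V) : V →L[ℝ] V →L[ℝ] V →L[ℝ] ℝ :=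
  let D₁ : V →L[ℝ] V →L[ℝ] V →L[ℝ] ℝ := fderiv ℝ G y
  let D₂ : V →L[ℝ] V →L[ℝ] V →L[ℝ] ℝ := D₁.flip
  let D₃ : V →L[ℝ] V →L[ℝ] V →L[ℝ] ℝ :=
    (ContinuousLinearMap.flipₗᵢ ℝ V V ℝ).toContinuousLinearEquiv.toContinuousLinearMap ∘L D₂
  (1 / 2 : ℝ) • (D₁ + D₂ - D₃)

theorem christoffelFirst_apply (G : V → V →L[ℝ] V →L[ℝ] ℝ) (y u v w : V) :
    christoffelFirst G y u v w =
      1 / 2 * (fderiv ℝ G y u v w + fderiv ℝ G y v u w - fderiv ℝ G y w u v) := by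
  simp [christoffelFirst]

/-- Christoffel symbols of the second kind, i.e. the Levi-Civita derivative `∇_u v` of the constant
field `v`: the vector `Γ(u, v)` determined by `G(Γ(u, v), w) = Γ(u, v; w)` for all `w`. -/
def christoffel (G : V → V →L[ℝ] V →L[ℝ] ℝ) (y : V) : V →L[ℝ] V →L[ℝ] V :=
  (ContinuousLinearMap.compL ℝ V (V →L[ℝ] ℝ) V (G y).inverse) ∘L christoffelFirst G y

/-- The defining property of `christoffel`, for a metric which is nondegenerate at `y`. -/
theorem christoffel_spec [FiniteDimensional ℝ V] (G : V → V →L[ℝ] V →L[ℝ] ℝ) (y : V)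
    (hG : ∀ u, (∀ w, G y u w = 0) → u = 0) (u v w : V) :
    G y (christoffel G y u v) w = christoffelFirst G y u v w := by
  have hinj : Function.Injective (G y) := by
    rw [injective_iff_map_eq_zero]
    intro u hu
    exact hG u fun w => by rw [hu]; rfl
  have hfin : Module.finrank ℝ V = Module.finrank ℝ (V →L[ℝ] ℝ) := by
    rw [← LinearEquiv.finrank_eq (LinearMap.toContinuousLinearMap (𝕜 := ℝ) (E := V) (F' := ℝ))]
    exact (Subspace.dual_finrank_eq (K := ℝ) (V := V)).symm
  let L : V ≃L[ℝ] (V →L[ℝ] ℝ) :=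
    (LinearEquiv.ofInjectiveOfFinrankEq (G y : V →ₗ[ℝ] (V →L[ℝ] ℝ)) hinj hfin).toContinuousLinearEquiv
  have hL : G y = (L : V →L[ℝ] (V →L[ℝ] ℝ)) := by ext u w; rfl
  have h1 : christoffel G y u v = L.symm (christoffelFirst G y u v) := by
    simp only [christoffel, hL, ContinuousLinearMap.inverse_equiv]
    rfl
  rw [h1, hL]
  simp

/-- The endomorphism `w ↦ R(w, u) v` of the curvature tensor
`R(w, u) v = ∇_w ∇_u v - ∇_u ∇_w v` (for constant fields `u`, `v`, `w`). -/
def curvatureEndo (G : V → V →L[ℝ] V →L[ℝ] ℝ) (y u v : V) : V →ₗ[ℝ] V where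
  toFun w := fderiv ℝ (christoffel G) y w u v - fderiv ℝ (christoffel G) y u w v
    + christoffel G y w (christoffel G y u v) - christoffel G y u (christoffel G y w v)
  map_add' w w' := by
    simp only [map_add, add_apply]; abel
  map_smul' c w := by
    simp only [map_smul, smul_apply, RingHom.id_apply, smul_sub, smul_add]

/-- The Ricci tensor in coordinates, `Ric(u, v) = tr (w ↦ R(w, u) v)`. -/
def ricciInCoordinates (G : V → V →L[ℝ] V →L[ℝ] ℝ) (y u v : V) : ℝ :=
  LinearMap.trace ℝ V (curvatureEndo G y u v)

end Coordinates

/-! ### Semi-Riemannian metrics on manifolds without boundary -/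

section Manifolds

variable {E : Type*} [NormedAddCommGroup E] [NormedSpace ℝ E]
  {H : Type*} [TopologicalSpace H] (I : ModelWithCorners ℝ E H)
  {M : Type*} [TopologicalSpace M] [ChartedSpace H M]

/-- The coordinate expression, in the chart `e`, of a field `g` of bilinear forms on the tangent
spaces of `M`: the pullback of `g` under the parametrization `e⁻¹`. -/
def inChart (g : ∀ x : M, TangentSpace I x →L[ℝ] TangentSpace I x →L[ℝ] ℝ)
    (e : OpenPartialHomeomorph M H) (y : E) : E →L[ℝ] E →L[ℝ] ℝ :=
  let b : E →L[ℝ] E →L[ℝ] ℝ := g ((e.extend I).symm y)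
  let D : E →L[ℝ] E := mfderiv 𝓘(ℝ, E) I (e.extend I).symm y
  b.bilinearComp D D

variable (M) in
/-- A semi-Riemannian metric on a boundaryless manifold: a smooth field of symmetric nondegenerate
bilinear forms on the tangent spaces. Smoothness means that the coordinate expressions in all charts
of the atlas are smooth. (The index is then locally constant, hence constant if `M` is
connected.) -/
structure SemiRiemannianMetric [FiniteDimensional ℝ E] [I.Boundaryless] [IsManifold I ∞ M] where
  /-- the bilinear form on each tangent space -/
  val : ∀ x : M, TangentSpace I x →L[ℝ] TangentSpace I x →L[ℝ] ℝ
  symm : ∀ (x : M) (u v : TangentSpace I x), val x u v = val x v u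
  nondegenerate : ∀ (x : M) (u : TangentSpace I x), (∀ v, val x u v = 0) → u = 0
  smooth : ∀ e ∈ atlas H M, ContDiffOn ℝ ∞ (inChart I val e) (e.extend I).target

variable {I} in
/-- The metric `g` is Einstein with constant Ricci curvature `lam`: `Ric(g) = lam • g`, in every
chart of the atlas. -/
def SemiRiemannianMetric.IsEinstein [FiniteDimensional ℝ E] [I.Boundaryless] [IsManifold I ∞ M]
    (g : SemiRiemannianMetric I M) (lam : ℝ) : Prop :=
  ∀ e ∈ atlas H M, ∀ y ∈ (e.extend I).target, ∀ u v : E,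
    ricciInCoordinates (inChart I g.val e) y u v = lam * inChart I g.val e y u v

end Manifolds

/-! ### Warped products -/

section WarpedProduct

variable {E : Type*} [NormedAddCommGroup E] [NormedSpace ℝ E]
  {H : Type*} [TopologicalSpace H] {I : ModelWithCorners ℝ E H}
  {B : Type*} [TopologicalSpace B] [ChartedSpace H B]
  {E' : Type*} [NormedAddCommGroup E'] [NormedSpace ℝ E']
  {H' : Type*} [TopologicalSpace H'] {J : ModelWithCorners ℝ E' H'}
  {F : Type*} [TopologicalSpace F] [ChartedSpace H' F]

/-- The field of bilinear forms `g_B + f² g_F` on `B × F`, i.e.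
`((u₁, u₂), (v₁, v₂)) ↦ g_B(u₁, v₁) + f(x)² g_F(u₂, v₂)` at `(x, z)`. -/
def warpedForm (gB : ∀ x : B, TangentSpace I x →L[ℝ] TangentSpace I x →L[ℝ] ℝ)
    (gF : ∀ z : F, TangentSpace J z →L[ℝ] TangentSpace J z →L[ℝ] ℝ) (f : B → ℝ) (p : B × F) :
    TangentSpace (I.prod J) p →L[ℝ] TangentSpace (I.prod J) p →L[ℝ] ℝ :=
  let b : E →L[ℝ] E →L[ℝ] ℝ := gB p.1
  let c : E' →L[ℝ] E' →L[ℝ] ℝ := gF p.2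
  (b.bilinearComp (ContinuousLinearMap.fst ℝ E E') (ContinuousLinearMap.fst ℝ E E') +
    f p.1 ^ 2 •
      c.bilinearComp (ContinuousLinearMap.snd ℝ E E') (ContinuousLinearMap.snd ℝ E E') :
    E × E' →L[ℝ] E × E' →L[ℝ] ℝ)

theorem mdifferentiableAt_extend_symm [I.Boundaryless] [IsManifold I ∞ B]
    {e : OpenPartialHomeomorph B H} (he : e ∈ atlas H B) {y : E} (hy : y ∈ (e.extend I).target) :
    MDifferentiableAt 𝓘(ℝ, E) I (e.extend I).symm y := by
  have h := contMDiffOn_extend_symm (I := I) (n := ∞)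
    (IsManifold.subset_maximalAtlas (I := I) (n := ∞) he)
  have ht : (e.extend I).target = I '' e.target := by
    rw [e.extend_target, I.image_eq]
  rw [← ht] at h
  exact (h.contMDiffAt (e.isOpen_extend_target.mem_nhds hy)).mdifferentiableAt (by simp)

theorem inChart_warpedForm [I.Boundaryless] [J.Boundaryless] [IsManifold I ∞ B]
    [IsManifold J ∞ F]
    (gB : ∀ x : B, TangentSpace I x →L[ℝ] TangentSpace I x →L[ℝ] ℝ)
    (gF : ∀ z : F, TangentSpace J z →L[ℝ] TangentSpace J z →L[ℝ] ℝ) (f : B → ℝ)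
    {e : OpenPartialHomeomorph B H} (he : e ∈ atlas H B)
    {e' : OpenPartialHomeomorph F H'} (he' : e' ∈ atlas H' F)
    {y : E × E'} (hy : y.1 ∈ (e.extend I).target) (hy' : y.2 ∈ (e'.extend J).target) :
    inChart (I.prod J) (warpedForm gB gF f) (e.prod e') y =
      (inChart I gB e y.1).bilinearComp
          (ContinuousLinearMap.fst ℝ E E') (ContinuousLinearMap.fst ℝ E E') +
        f ((e.extend I).symm y.1) ^ 2 • (inChart J gF e' y.2).bilinearComp
          (ContinuousLinearMap.snd ℝ E E') (ContinuousLinearMap.snd ℝ E E') := by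
  have hd := (mdifferentiableAt_extend_symm (I := I) he hy)
  have hd' := (mdifferentiableAt_extend_symm (I := J) he' hy')
  have key := mfderiv_prodMap (p := y) hd hd'
  rw [← modelWithCornersSelf_prod, chartedSpaceSelf_prod] at key
  have hfun : (((e.prod e').extend (I.prod J)).symm : E × E' → B × F) =
      Prod.map (e.extend I).symm (e'.extend J).symm := by
    rw [OpenPartialHomeomorph.extend_prod]; rfl
  have h1 : (((e.prod e').extend (I.prod J)).symm y).1 = (e.extend I).symm y.1 := by rw [hfun]; rfl
  have h2 : (((e.prod e').extend (I.prod J)).symm y).2 = (e'.extend J).symm y.2 := by rw [hfun]; rfl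
  simp only [inChart]
  rw [hfun]
  erw [key]
  refine ContinuousLinearMap.ext fun u => ContinuousLinearMap.ext fun v => ?_
  rfl

theorem contDiffOn_pullback {X : Type*} [NormedAddCommGroup X] [NormedSpace ℝ X]
    {b : X → E →L[ℝ] E →L[ℝ] ℝ} {s : Set X} (hb : ContDiffOn ℝ ∞ b s) (L : E' →L[ℝ] E) :
    ContDiffOn ℝ ∞ (fun x => (b x).bilinearComp L L) s := by
  have h : ∀ x, (b x).bilinearComp L L =
      ((ContinuousLinearMap.compL ℝ E' E ℝ).flip L) ∘L (b x) ∘L L := fun x => rfl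
  simp only [h]
  exact contDiffOn_const.clm_comp (hb.clm_comp contDiffOn_const)

/-- The warped product metric `g_B + f² g_F` on `B ×_f F`. -/
def warpedProduct [FiniteDimensional ℝ E] [FiniteDimensional ℝ E'] [I.Boundaryless]
    [J.Boundaryless] [IsManifold I ∞ B] [IsManifold J ∞ F]
    (gB : SemiRiemannianMetric I B) (gF : SemiRiemannianMetric J F)
    (f : B → ℝ) (hf : ContMDiff I 𝓘(ℝ, ℝ) ∞ f) (hpos : ∀ x, 0 < f x) :
    SemiRiemannianMetric (I.prod J) (B × F) where
  val := warpedForm gB.val gF.val f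
  symm p u v := by
    exact congrArg₂ (· + ·) (gB.symm p.1 u.1 v.1) (congrArg (f p.1 ^ 2 * ·) (gF.symm p.2 u.2 v.2))
  nondegenerate p u h := by
    have h1 : (u.1 : E) = 0 := gB.nondegenerate p.1 u.1 fun v => by
      have h0 := h ((v, 0) : E × E')
      change gB.val p.1 u.1 v + f p.1 ^ 2 * gF.val p.2 u.2 0 = 0 at h0
      simpa using h0
    have h2 : (u.2 : E') = 0 := gF.nondegenerate p.2 u.2 fun v => by
      have h0 := h ((0, v) : E × E')
      change gB.val p.1 u.1 0 + f p.1 ^ 2 * gF.val p.2 u.2 v = 0 at h0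
      simpa [(hpos p.1).ne'] using h0
    exact Prod.ext h1 h2
  smooth := by
    rintro _ ⟨e, he, e', he', rfl⟩
    have ht : ((e.prod e').extend (I.prod J)).target =
        (e.extend I).target ×ˢ (e'.extend J).target := by
      rw [OpenPartialHomeomorph.extend_prod]; rfl
    have hfs : ContDiffOn ℝ ∞ (fun y : E => f ((e.extend I).symm y)) (e.extend I).target := by
      intro y hy
      have h := contMDiffOn_extend_symm (I := I) (n := ∞)
        (IsManifold.subset_maximalAtlas (I := I) (n := ∞) he)
      have ht' : (e.extend I).target = I '' e.target := by
        rw [e.extend_target, I.image_eq]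
      rw [← ht'] at h
      exact (contMDiffOn_iff_contDiffOn.mp (hf.comp_contMDiffOn h)) y hy
    rw [ht]
    have m1 : Set.MapsTo (Prod.fst : E × E' → E)
        ((e.extend I).target ×ˢ (e'.extend J).target) (e.extend I).target := fun y hy => hy.1
    have m2 : Set.MapsTo (Prod.snd : E × E' → E')
        ((e.extend I).target ×ˢ (e'.extend J).target) (e'.extend J).target := fun y hy => hy.2
    have s1 := (gB.smooth e he).comp contDiff_fst.contDiffOn m1
    have s2 := (gF.smooth e' he').comp contDiff_snd.contDiffOn m2
    have s3 := hfs.comp contDiff_fst.contDiffOn m1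
    have c1 := contDiffOn_pullback s1 (ContinuousLinearMap.fst ℝ E E')
    have c2 := contDiffOn_pullback s2 (ContinuousLinearMap.snd ℝ E E')
    refine ContDiffOn.congr (c1.add ((s3.pow 2).smul c2)) ?_
    intro y hy
    exact inChart_warpedForm gB.val gF.val f he he' hy.1 hy.2

end WarpedProduct

/-! ### Pseudo-Euclidean space and its conformal metrics -/

section PseudoEuclidean

variable {n : ℕ}

/-- The pseudo-Euclidean scalar product `g(u, v) = ∑ i, ε i * u i * v i`. -/
def pseudoEuclideanForm (ε : Fin n → ℝ) :
    EuclideanSpace ℝ (Fin n) →L[ℝ] EuclideanSpace ℝ (Fin n) →L[ℝ] ℝ :=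
  ∑ i, ε i • (EuclideanSpace.proj i : EuclideanSpace ℝ (Fin n) →L[ℝ] ℝ).smulRight
    (EuclideanSpace.proj i : EuclideanSpace ℝ (Fin n) →L[ℝ] ℝ)

theorem pseudoEuclideanForm_apply (ε : Fin n → ℝ) (u v : EuclideanSpace ℝ (Fin n)) :
    pseudoEuclideanForm ε u v = ∑ i, ε i * u i * v i := by
  simp [pseudoEuclideanForm, mul_assoc]

/-- In the identity chart of a vector space, the coordinate expression of `g` is `g` itself. -/
theorem inChart_refl {E : Type*} [NormedAddCommGroup E] [NormedSpace ℝ E]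
    (g : E → E →L[ℝ] E →L[ℝ] ℝ) (y : E) :
    inChart 𝓘(ℝ, E) (M := E) g (OpenPartialHomeomorph.refl E) y = g y := by
  have h : mfderiv 𝓘(ℝ, E) 𝓘(ℝ, E)
      ((OpenPartialHomeomorph.refl E).extend 𝓘(ℝ, E)).symm y = ContinuousLinearMap.id ℝ E :=
    mfderiv_id
  simp only [inChart]
  erw [h]
  rfl

/-- The metric `φ⁻² g` on `ℝⁿ`, conformal to the pseudo-Euclidean metric `g = diag(ε)`. -/
def conformalMetric (ε : Fin n → ℝ) (hε : ∀ i, ε i = 1 ∨ ε i = -1)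
    (φ : EuclideanSpace ℝ (Fin n) → ℝ) (hφ : ContDiff ℝ ∞ φ) (hφ0 : ∀ x, φ x ≠ 0) :
    SemiRiemannianMetric (𝓡 n) (EuclideanSpace ℝ (Fin n)) where
  val x := ((1 / φ x ^ 2) • pseudoEuclideanForm ε :
    EuclideanSpace ℝ (Fin n) →L[ℝ] EuclideanSpace ℝ (Fin n) →L[ℝ] ℝ)
  symm x := (fun u v => by
    simp only [smul_apply, pseudoEuclideanForm_apply, mul_right_comm] :
    ∀ u v : EuclideanSpace ℝ (Fin n), ((1 / φ x ^ 2) • pseudoEuclideanForm ε) u v =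
      ((1 / φ x ^ 2) • pseudoEuclideanForm ε) v u)
  nondegenerate x := (fun u h => by
    have h' : ∀ v, pseudoEuclideanForm ε u v = 0 := fun v => by
      simpa [hφ0 x] using h v
    refine PiLp.ext fun i => ?_
    have h1 := h' (EuclideanSpace.single i 1)
    rw [pseudoEuclideanForm_apply, Finset.sum_eq_single i] at h1
    · rcases hε i with h2 | h2 <;> simpa [h2] using h1
    · intro j _ hj
      simp [hj]
    · simp :
    ∀ u : EuclideanSpace ℝ (Fin n), (∀ v : EuclideanSpace ℝ (Fin n),
      ((1 / φ x ^ 2) • pseudoEuclideanForm ε) u v = 0) → u = 0)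
  smooth := by
    intro e he
    rw [chartedSpaceSelf_atlas] at he
    subst he
    have hG : ∀ y : EuclideanSpace ℝ (Fin n),
        inChart (𝓡 n) (M := EuclideanSpace ℝ (Fin n))
          (fun x => ((1 / φ x ^ 2) • pseudoEuclideanForm ε :
            EuclideanSpace ℝ (Fin n) →L[ℝ] EuclideanSpace ℝ (Fin n) →L[ℝ] ℝ))
          (OpenPartialHomeomorph.refl _) y = (1 / φ y ^ 2) • pseudoEuclideanForm ε :=
      inChart_refl _
    have hs : ContDiff ℝ ∞ fun y => (1 / φ y ^ 2) • pseudoEuclideanForm ε :=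
      (contDiff_const.div (hφ.pow 2) fun x => pow_ne_zero 2 (hφ0 x)).smul contDiff_const
    exact ContDiffOn.congr hs.contDiffOn fun y _ => hG y

/-- The linear function `ξ(x) = ∑ i, α i * x i`. -/
def xiForm (α : Fin n → ℝ) : EuclideanSpace ℝ (Fin n) →L[ℝ] ℝ :=
  ∑ i, α i • (EuclideanSpace.proj i : EuclideanSpace ℝ (Fin n) →L[ℝ] ℝ)

theorem xiForm_apply (α : Fin n → ℝ) (x : EuclideanSpace ℝ (Fin n)) :
    xiForm α x = ∑ i, α i * x i := by
  simp [xiForm]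

end PseudoEuclidean

end

/-!
The charts of the warped product are products of the identity chart of `ℝⁿ` with charts of `F`, and
in such a chart the metric is `φ(ξ)⁻² g + f(ξ)² h`, where `g` is constant and `h` is the coordinate
expression of the metric of `F`. Its Levi-Civita connection is read off from the Koszul formula
(`christoffel_conformalWarpedForm`): with `A` the `g`-gradient of the linear form `ξ`, all
coefficients are functions of `ξ` times `ξ`, `g`, `h`, `A` and the connection of `h`. The curvature
endomorphism therefore has diagonal blocks which are a multiple of the identity plus operators of
rank one (plus the curvature of `h` on the fibre block), so that the traces are immediate and
`Ric = c₁ ξ ⊗ ξ + c₂ g + Ric(h) + c₃ h` (`ricciInCoordinates_conformalWarpedForm`).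

When `Ric(h) = λ_F h`, the Einstein equation becomes the vanishing of a combination of `ξ ⊗ ξ`, `g`
and `h` whose coefficients are, up to nowhere vanishing factors, the three differential equations
(`ricciInCoordinates_conformalWarpedForm_sub`). Since `ξ ⊗ ξ` and `g` are linearly independent in
dimension at least two, and `h ≠ 0`, each coefficient vanishes; as `ξ` is onto `ℝ` this gives the
three equations on all of `ℝ` (`isEinstein_warpedProduct_iff`), whatever the value of
`g(A, A) = ∑ εᵢ αᵢ²`. If that value is zero, the last two equations reduce to `λ = 0` and
`λ_F = 0`.
-/

/-! ### Generalities on the Ricci tensor in coordinates -/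

section Coordinates

variable {V : Type*} [NormedAddCommGroup V] [NormedSpace ℝ V]

theorem christoffel_congr {G G' : V → V →L[ℝ] V →L[ℝ] ℝ} {y : V} (h : G =ᶠ[nhds y] G') :
    christoffel G =ᶠ[nhds y] christoffel G' := by
  filter_upwards [h.eventuallyEq_nhds] with x hx
  simp only [christoffel, christoffelFirst, hx.fderiv_eq, hx.eq_of_nhds]

/-- The Ricci tensor at a point only depends on the germ of the metric there. -/
theorem ricciInCoordinates_congr {G G' : V → V →L[ℝ] V →L[ℝ] ℝ} {y : V} (h : G =ᶠ[nhds y] G')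
    (u v : V) : ricciInCoordinates G y u v = ricciInCoordinates G' y u v := by
  have hc := christoffel_congr h
  have : curvatureEndo G y u v = curvatureEndo G' y u v := by
    ext w
    simp only [curvatureEndo, hc.fderiv_eq, hc.eq_of_nhds]
  rw [ricciInCoordinates, this, ricciInCoordinates]

/-- A derivative of a bilinear-map-valued function may be computed after evaluation at constant
vectors. -/
theorem fderiv_apply_apply {X : Type*} [NormedAddCommGroup X] [NormedSpace ℝ X]
    {Y : Type*} [NormedAddCommGroup Y] [NormedSpace ℝ Y]
    {c : X → V →L[ℝ] V →L[ℝ] Y} {y : X} (hc : DifferentiableAt ℝ c y) (w : X) (u v : V) :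
    fderiv ℝ c y w u v = fderiv ℝ (fun x => c x u v) y w := by
  have h := ((hc.hasFDerivAt.clm_apply (hasFDerivAt_const u y)).clm_apply (hasFDerivAt_const v y))
  rw [h.fderiv]
  simp

theorem fderiv_symm {G : V → V →L[ℝ] V →L[ℝ] ℝ} {y : V} (hG : DifferentiableAt ℝ G y)
    (hs : ∀ᶠ x in nhds y, ∀ u v, G x u v = G x v u) (w u v : V) :
    fderiv ℝ G y w u v = fderiv ℝ G y w v u := by
  rw [fderiv_apply_apply hG, fderiv_apply_apply hG]
  have : (fun x => G x u v) =ᶠ[nhds y] fun x => G x v u := hs.mono fun x hx => hx u v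
  rw [this.fderiv_eq]

theorem christoffel_symm {G : V → V →L[ℝ] V →L[ℝ] ℝ} {y : V} (hG : DifferentiableAt ℝ G y)
    (hs : ∀ᶠ x in nhds y, ∀ u v, G x u v = G x v u) (u v : V) :
    christoffel G y u v = christoffel G y v u := by
  have : christoffelFirst G y u v = christoffelFirst G y v u := by
    ext w
    rw [christoffelFirst_apply, christoffelFirst_apply, fderiv_symm hG hs w u v]
    ring
  simp [christoffel, this]

variable [FiniteDimensional ℝ V]

/-- A nondegenerate bilinear form on a finite-dimensional space is an isomorphism onto the dual. -/
theorem isInvertible_of_nondegenerate {b : V →L[ℝ] V →L[ℝ] ℝ}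
    (hb : ∀ u, (∀ w, b u w = 0) → u = 0) : b.IsInvertible := by
  have hinj : Function.Injective b := by
    rw [injective_iff_map_eq_zero]
    intro u hu
    exact hb u fun w => by rw [hu]; rfl
  have hfin : Module.finrank ℝ V = Module.finrank ℝ (V →L[ℝ] ℝ) := by
    rw [← LinearEquiv.finrank_eq (LinearMap.toContinuousLinearMap (𝕜 := ℝ) (E := V) (F' := ℝ))]
    exact (Subspace.dual_finrank_eq (K := ℝ) (V := V)).symm
  exact ⟨(LinearEquiv.ofInjectiveOfFinrankEq (b : V →ₗ[ℝ] (V →L[ℝ] ℝ)) hinj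
    hfin).toContinuousLinearEquiv, by ext u w; rfl⟩

/-- The inverse of the metric, taken with `ContinuousLinearMap.inverse`, is smooth near a point where
the metric is nondegenerate; hence so are the Christoffel symbols. -/
theorem differentiableAt_christoffel {G : V → V →L[ℝ] V →L[ℝ] ℝ} {y : V}
    (hG : ContDiffAt ℝ ∞ G y) (hn : ∀ u, (∀ w, G y u w = 0) → u = 0) :
    DifferentiableAt ℝ (christoffel G) y := by
  have hinv : DifferentiableAt ℝ (fun x => (G x).inverse) y := by
    have h1 := (isInvertible_of_nondegenerate hn).contDiffAt_map_inverse (n := 1)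
    exact (h1.differentiableAt (by simp)).comp y (hG.differentiableAt (by simp))
  have hD : DifferentiableAt ℝ (fderiv ℝ G) y :=
    (hG.fderiv_right (m := 1) (by norm_cast)).differentiableAt (by simp)
  have hD2 : DifferentiableAt ℝ (fun x => (fderiv ℝ G x).flip) y :=
    (ContinuousLinearMap.flipₗᵢ ℝ V V (V →L[ℝ] ℝ)).toContinuousLinearEquiv.differentiableAt.comp y hD
  have hfirst : DifferentiableAt ℝ (christoffelFirst G) y :=
    (((hD.add hD2).sub ((differentiableAt_const _).clm_comp hD2))).const_smul (1 / 2 : ℝ)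
  have hcomp : DifferentiableAt ℝ
      (fun x => ContinuousLinearMap.compL ℝ V (V →L[ℝ] ℝ) V ((G x).inverse)) y :=
    (ContinuousLinearMap.differentiableAt _).comp y hinv
  exact hcomp.clm_comp hfirst

theorem christoffel_eq_of_forall {G : V → V →L[ℝ] V →L[ℝ] ℝ} {y : V}
    (hn : ∀ u, (∀ w, G y u w = 0) → u = 0) {u v x : V}
    (hx : ∀ w, G y x w = christoffelFirst G y u v w) : christoffel G y u v = x := by
  rw [← sub_eq_zero]
  refine hn _ fun w => ?_
  rw [map_sub, sub_apply, christoffel_spec G y hn, hx, sub_self]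

end Coordinates

section Trace

variable {V W : Type*} [AddCommGroup V] [Module ℝ V] [FiniteDimensional ℝ V]
  [AddCommGroup W] [Module ℝ W] [FiniteDimensional ℝ W]

/-- The trace of an endomorphism of `V × W` is the sum of the traces of its diagonal blocks. -/
theorem trace_prod_eq_add (T : V × W →ₗ[ℝ] V × W) :
    LinearMap.trace ℝ (V × W) T =
      LinearMap.trace ℝ V (LinearMap.fst ℝ V W ∘ₗ T ∘ₗ LinearMap.inl ℝ V W) +
      LinearMap.trace ℝ W (LinearMap.snd ℝ V W ∘ₗ T ∘ₗ LinearMap.inr ℝ V W) := by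
  have h : T = LinearMap.inl ℝ V W ∘ₗ (LinearMap.fst ℝ V W ∘ₗ T) +
      LinearMap.inr ℝ V W ∘ₗ (LinearMap.snd ℝ V W ∘ₗ T) := by
    apply LinearMap.ext
    intro x
    simp
  conv_lhs => rw [h, map_add, LinearMap.trace_comp_comm' _ (LinearMap.inl ℝ V W),
    LinearMap.trace_comp_comm' _ (LinearMap.inr ℝ V W)]
  rfl

end Trace

/-! ### Ricci tensor of a warped product with conformally flat base -/

section WarpedCoordinates

variable {V : Type*} [NormedAddCommGroup V] [NormedSpace ℝ V]
  {W : Type*} [NormedAddCommGroup W] [NormedSpace ℝ W]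

/-- The metric `φ(ξ)⁻² g + f(ξ)² h` on `V × W`, for a constant bilinear form `g` and a linear form
`ξ` on `V`, and a field `h` of bilinear forms on `W`. -/
noncomputable def conformalWarpedForm (g : V →L[ℝ] V →L[ℝ] ℝ) (ξ : V →L[ℝ] ℝ) (φ f : ℝ → ℝ)
    (h : W → W →L[ℝ] W →L[ℝ] ℝ) (y : V × W) : V × W →L[ℝ] V × W →L[ℝ] ℝ :=
  (1 / φ (ξ y.1) ^ 2) •
      g.bilinearComp (ContinuousLinearMap.fst ℝ V W) (ContinuousLinearMap.fst ℝ V W) +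
    f (ξ y.1) ^ 2 •
      (h y.2).bilinearComp (ContinuousLinearMap.snd ℝ V W) (ContinuousLinearMap.snd ℝ V W)

variable {g : V →L[ℝ] V →L[ℝ] ℝ} {ξ : V →L[ℝ] ℝ} {φ f : ℝ → ℝ} {h : W → W →L[ℝ] W →L[ℝ] ℝ}

theorem conformalWarpedForm_apply (y u v : V × W) :
    conformalWarpedForm g ξ φ f h y u v =
      1 / φ (ξ y.1) ^ 2 * g u.1 v.1 + f (ξ y.1) ^ 2 * h y.2 u.2 v.2 := rfl

theorem contDiffAt_conformalWarpedForm (hφ : ContDiff ℝ ∞ φ) (hf : ContDiff ℝ ∞ f)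
    (hφ0 : ∀ t, φ t ≠ 0) {y : V × W} (hh : ContDiffAt ℝ ∞ h y.2) :
    ContDiffAt ℝ ∞ (conformalWarpedForm g ξ φ f h) y := by
  have hξ : ContDiff ℝ ∞ fun y : V × W => ξ y.1 := ξ.contDiff.comp contDiff_fst
  have h1 : ContDiffAt ℝ ∞ (fun y : V × W => 1 / φ (ξ y.1) ^ 2) y :=
    (contDiff_const.div ((hφ.comp hξ).pow 2) fun x => pow_ne_zero 2 (hφ0 _)).contDiffAt
  have h2 : ContDiffAt ℝ ∞ (fun y : V × W => f (ξ y.1) ^ 2) y := ((hf.comp hξ).pow 2).contDiffAt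
  have h3 : ContDiffAt ℝ ∞ (fun y : V × W => h y.2) y := hh.comp y contDiffAt_snd
  have h4 : ∀ y : V × W, (h y.2).bilinearComp (ContinuousLinearMap.snd ℝ V W)
      (ContinuousLinearMap.snd ℝ V W) =
      ((ContinuousLinearMap.compL ℝ (V × W) W ℝ).flip (ContinuousLinearMap.snd ℝ V W)) ∘L
        (h y.2) ∘L (ContinuousLinearMap.snd ℝ V W) := fun _ => rfl
  refine (h1.smul contDiffAt_const).add (h2.smul ?_)
  simp only [h4]
  exact contDiffAt_const.clm_comp (h3.clm_comp contDiffAt_const)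

theorem nondegenerate_conformalWarpedForm (hg : ∀ u, (∀ w, g u w = 0) → u = 0)
    (hφ0 : ∀ t, φ t ≠ 0) (hfpos : ∀ t, 0 < f t) {y : V × W}
    (hn : ∀ u, (∀ w, h y.2 u w = 0) → u = 0) (u : V × W)
    (hu : ∀ w, conformalWarpedForm g ξ φ f h y u w = 0) : u = 0 := by
  have h1 : u.1 = 0 := hg _ fun w => by
    have := hu (w, 0)
    simpa [conformalWarpedForm_apply, hφ0] using this
  have h2 : u.2 = 0 := hn _ fun w => by
    have := hu (0, w)
    simpa [conformalWarpedForm_apply, (hfpos _).ne'] using this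
  exact Prod.ext h1 h2

theorem fderiv_conformalWarpedForm (hφ : ContDiff ℝ ∞ φ) (hf : ContDiff ℝ ∞ f)
    (hφ0 : ∀ t, φ t ≠ 0) {y : V × W} (hh : ContDiffAt ℝ ∞ h y.2) (w u v : V × W) :
    fderiv ℝ (conformalWarpedForm g ξ φ f h) y w u v =
      -2 * deriv φ (ξ y.1) / φ (ξ y.1) ^ 3 * ξ w.1 * g u.1 v.1 +
        2 * f (ξ y.1) * deriv f (ξ y.1) * ξ w.1 * h y.2 u.2 v.2 +
        f (ξ y.1) ^ 2 * fderiv ℝ h y.2 w.2 u.2 v.2 := by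
  have hh' := hh.differentiableAt (by simp)
  rw [fderiv_apply_apply
    ((contDiffAt_conformalWarpedForm hφ hf hφ0 hh).differentiableAt (by simp)),
    fderiv_apply_apply hh']
  simp only [conformalWarpedForm_apply]
  have hξ : HasFDerivAt (fun y : V × W => ξ y.1) (ξ ∘L ContinuousLinearMap.fst ℝ V W) y :=
    (ξ ∘L ContinuousLinearMap.fst ℝ V W).hasFDerivAt
  have dφ := ((hφ.differentiable (by simp)) (ξ y.1)).hasDerivAt
  have df := ((hf.differentiable (by simp)) (ξ y.1)).hasDerivAt
  have h1 := (((hasDerivAt_const (ξ y.1) (1 : ℝ)).div (dφ.pow 2)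
    (pow_ne_zero 2 (hφ0 _))).comp_hasFDerivAt y hξ).mul_const (g u.1 v.1)
  have h2 := (df.pow 2).comp_hasFDerivAt y hξ
  have h3 : HasFDerivAt (fun y : V × W => h y.2 u.2 v.2)
      (fderiv ℝ (fun z => h z u.2 v.2) y.2 ∘L ContinuousLinearMap.snd ℝ V W) y := by
    have : DifferentiableAt ℝ (fun z => h z u.2 v.2) y.2 := by fun_prop
    exact this.hasFDerivAt.comp y hasFDerivAt_snd
  have H := h1.add (h2.mul h3)
  have e := H.fderiv
  have e' := congrArg (fun L => L w) e
  refine e'.trans ?_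
  have := hφ0 (ξ y.1)
  simp
  field_simp
  ring

variable [FiniteDimensional ℝ V] [FiniteDimensional ℝ W]

/-- The Christoffel symbols of `φ(ξ)⁻² g + f(ξ)² h`, where `A` is the `g`-gradient of `ξ`: those of
the conformally flat base and of the fibre, with the warping terms `-f h(·, ·) ∇f` in the base and
`(df/f) ⊗ id` symmetrized in the fibre. -/
theorem christoffel_conformalWarpedForm (hφ : ContDiff ℝ ∞ φ) (hf : ContDiff ℝ ∞ f)
    (hφ0 : ∀ t, φ t ≠ 0) (hfpos : ∀ t, 0 < f t)
    (hgs : ∀ u v, g u v = g v u) (hg : ∀ u, (∀ w, g u w = 0) → u = 0)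
    {A : V} (hA : ∀ w, g A w = ξ w) {y : V × W} (hh : ContDiffAt ℝ ∞ h y.2)
    (hn : ∀ u, (∀ w, h y.2 u w = 0) → u = 0) (u v : V × W) :
    christoffel (conformalWarpedForm g ξ φ f h) y u v =
      (-(deriv φ (ξ y.1) / φ (ξ y.1)) • (ξ u.1 • v.1 + ξ v.1 • u.1 - g u.1 v.1 • A) -
          (φ (ξ y.1) ^ 2 * f (ξ y.1) * deriv f (ξ y.1) * h y.2 u.2 v.2) • A,
        christoffel h y.2 u.2 v.2 +
          (deriv f (ξ y.1) / f (ξ y.1)) • (ξ u.1 • v.2 + ξ v.1 • u.2)) := by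
  refine christoffel_eq_of_forall (nondegenerate_conformalWarpedForm hg hφ0 hfpos hn) fun w => ?_
  have h1 := christoffel_spec h y.2 hn u.2 v.2 w.2
  rw [christoffelFirst_apply] at h1
  rw [christoffelFirst_apply, conformalWarpedForm_apply]
  simp only [fderiv_conformalWarpedForm hφ hf hφ0 hh]
  simp only [map_add, map_sub, map_smul, add_apply, sub_apply, smul_apply, smul_eq_mul, h1, hA]
  rw [hgs u.1 w.1, hgs v.1 w.1]
  have := hφ0 (ξ y.1)
  have := (hfpos (ξ y.1)).ne'
  field_simp
  ring

end WarpedCoordinates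

section WarpedRicci

variable {V : Type*} [NormedAddCommGroup V] [NormedSpace ℝ V] [FiniteDimensional ℝ V]
  {W : Type*} [NormedAddCommGroup W] [NormedSpace ℝ W] [FiniteDimensional ℝ W]
  {g : V →L[ℝ] V →L[ℝ] ℝ} {ξ : V →L[ℝ] ℝ} {φ f : ℝ → ℝ} {h : W → W →L[ℝ] W →L[ℝ] ℝ}

/-- Derivative of the Christoffel symbols of `φ(ξ)⁻² g + f(ξ)² h`. The coefficient functions
`φ' / φ`, `f' / f` and `φ² f f'` of `ξ` enter only through their derivatives `p'`, `q'`, `r'`. -/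
theorem fderiv_christoffel_conformalWarpedForm (hφ : ContDiff ℝ ∞ φ) (hf : ContDiff ℝ ∞ f)
    (hφ0 : ∀ t, φ t ≠ 0) (hfpos : ∀ t, 0 < f t)
    (hgs : ∀ u v, g u v = g v u) (hg : ∀ u, (∀ w, g u w = 0) → u = 0)
    {A : V} (hA : ∀ w, g A w = ξ w) {y : V × W} (hh : ∀ᶠ z in nhds y.2, ContDiffAt ℝ ∞ h z)
    (hn : ∀ᶠ z in nhds y.2, ∀ u, (∀ w, h z u w = 0) → u = 0) {p' q' r' : ℝ}
    (hp : HasDerivAt (fun t => deriv φ t / φ t) p' (ξ y.1))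
    (hq : HasDerivAt (fun t => deriv f t / f t) q' (ξ y.1))
    (hr : HasDerivAt (fun t => φ t ^ 2 * f t * deriv f t) r' (ξ y.1)) (w u v : V × W) :
    fderiv ℝ (christoffel (conformalWarpedForm g ξ φ f h)) y w u v =
      (-(p' * ξ w.1) • (ξ u.1 • v.1 + ξ v.1 • u.1 - g u.1 v.1 • A) -
          (r' * ξ w.1 * h y.2 u.2 v.2 +
            φ (ξ y.1) ^ 2 * f (ξ y.1) * deriv f (ξ y.1) * fderiv ℝ h y.2 w.2 u.2 v.2) • A,
        fderiv ℝ (christoffel h) y.2 w.2 u.2 v.2 +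
          (q' * ξ w.1) • (ξ u.1 • v.2 + ξ v.1 • u.2)) := by
  have hh0 := hh.self_of_nhds
  have hn0 := hn.self_of_nhds
  have hh1 : DifferentiableAt ℝ h y.2 := hh0.differentiableAt (by simp)
  have hc1 : DifferentiableAt ℝ (christoffel h) y.2 := differentiableAt_christoffel hh0 hn0
  rw [fderiv_apply_apply (differentiableAt_christoffel
    (contDiffAt_conformalWarpedForm hφ hf hφ0 hh0)
    (nondegenerate_conformalWarpedForm hg hφ0 hfpos hn0)),
    fderiv_apply_apply hh1, fderiv_apply_apply hc1]
  have hξ : HasFDerivAt (fun y : V × W => ξ y.1) (ξ ∘L ContinuousLinearMap.fst ℝ V W) y :=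
    (ξ ∘L ContinuousLinearMap.fst ℝ V W).hasFDerivAt
  have h3 : HasFDerivAt (fun y : V × W => h y.2 u.2 v.2)
      (fderiv ℝ (fun z => h z u.2 v.2) y.2 ∘L ContinuousLinearMap.snd ℝ V W) y := by
    have : DifferentiableAt ℝ (fun z => h z u.2 v.2) y.2 := by fun_prop
    exact this.hasFDerivAt.comp y hasFDerivAt_snd
  have h4 : HasFDerivAt (fun y : V × W => christoffel h y.2 u.2 v.2)
      (fderiv ℝ (fun z => christoffel h z u.2 v.2) y.2 ∘L ContinuousLinearMap.snd ℝ V W) y := by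
    have : DifferentiableAt ℝ (fun z => christoffel h z u.2 v.2) y.2 := by fun_prop
    exact this.hasFDerivAt.comp y hasFDerivAt_snd
  have H := (((hp.comp_hasFDerivAt y hξ).neg.smul_const
      (ξ u.1 • v.1 + ξ v.1 • u.1 - g u.1 v.1 • A)).sub
    (((hr.comp_hasFDerivAt y hξ).mul h3).smul_const A)).prodMk
    (h4.add ((hq.comp_hasFDerivAt y hξ).smul_const (ξ u.1 • v.2 + ξ v.1 • u.2)))
  have H' := H.congr_of_eventuallyEq
      (f₁ := fun x => christoffel (conformalWarpedForm g ξ φ f h) x u v) (by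
    filter_upwards [continuousAt_snd.eventually hh, continuousAt_snd.eventually hn] with x h1 h2
    exact christoffel_conformalWarpedForm hφ hf hφ0 hfpos hgs hg hA h1 h2 u v)
  refine (congrArg (fun L => L w) H'.fderiv).trans ?_
  ext1
  · simp
    module
  · simp

/-- The Ricci tensor of `φ(ξ)⁻² g + f(ξ)² h` on `V × W`, where `A` is the `g`-gradient of the linear
form `ξ`. -/
theorem ricciInCoordinates_conformalWarpedForm (hφ : ContDiff ℝ ∞ φ) (hf : ContDiff ℝ ∞ f)
    (hφ0 : ∀ t, φ t ≠ 0) (hfpos : ∀ t, 0 < f t)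
    (hgs : ∀ u v, g u v = g v u) (hg : ∀ u, (∀ w, g u w = 0) → u = 0)
    {A : V} (hA : ∀ w, g A w = ξ w) {y : V × W} (hh : ∀ᶠ z in nhds y.2, ContDiffAt ℝ ∞ h z)
    (hs : ∀ᶠ z in nhds y.2, ∀ u v, h z u v = h z v u)
    (hn : ∀ᶠ z in nhds y.2, ∀ u, (∀ w, h z u w = 0) → u = 0) {p p' q q' r r' : ℝ}
    (hp0 : p = deriv φ (ξ y.1) / φ (ξ y.1)) (hq0 : q = deriv f (ξ y.1) / f (ξ y.1))
    (hr0 : r = φ (ξ y.1) ^ 2 * f (ξ y.1) * deriv f (ξ y.1))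
    (hp : HasDerivAt (fun t => deriv φ t / φ t) p' (ξ y.1))
    (hq : HasDerivAt (fun t => deriv f t / f t) q' (ξ y.1))
    (hr : HasDerivAt (fun t => φ t ^ 2 * f t * deriv f t) r' (ξ y.1)) (u v : V × W) :
    ricciInCoordinates (conformalWarpedForm g ξ φ f h) y u v =
      (((Module.finrank ℝ V : ℝ) - 2) * (p' + p ^ 2) -
          Module.finrank ℝ W * (q' + q ^ 2 + 2 * p * q)) * (ξ u.1 * ξ v.1) +
        ξ A * (p' - ((Module.finrank ℝ V : ℝ) - 2) * p ^ 2 + Module.finrank ℝ W * p * q) *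
          g u.1 v.1 +
        ricciInCoordinates h y.2 u.2 v.2 -
        ξ A * (r' - (Module.finrank ℝ V : ℝ) * p * r + ((Module.finrank ℝ W : ℝ) - 2) * q * r) *
          h y.2 u.2 v.2 := by
  have hh0 := hh.self_of_nhds
  have hn0 := hn.self_of_nhds
  have hcs : ∀ a b, christoffel h y.2 a b = christoffel h y.2 b a :=
    christoffel_symm (hh0.differentiableAt (by simp)) hs
  have hgA : ∀ w, g w A = ξ w := fun w => by rw [hgs, hA]
  have hC := christoffel_conformalWarpedForm (ξ := ξ) hφ hf hφ0 hfpos hgs hg hA hh0 hn0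
  have hD := fderiv_christoffel_conformalWarpedForm hφ hf hφ0 hfpos hgs hg hA hh hn hp hq hr
  rw [← hp0, ← hq0, ← hr0] at hC
  rw [← hr0] at hD
  obtain ⟨u₁, u₂⟩ := u
  obtain ⟨v₁, v₂⟩ := v
  rw [ricciInCoordinates, trace_prod_eq_add]
  -- both diagonal blocks of the curvature endomorphism are scalar up to operators of rank one and
  -- the curvature of `h`
  have hV : LinearMap.fst ℝ V W ∘ₗ
        curvatureEndo (conformalWarpedForm g ξ φ f h) y (u₁, u₂) (v₁, v₂) ∘ₗ
        LinearMap.inl ℝ V W =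
          (p' * ξ u₁ * ξ v₁ + p * (p * (2 * ξ u₁ * ξ v₁ - g u₁ v₁ * ξ A) + r * h y.2 u₂ v₂ * ξ A) -
            p ^ 2 * ξ u₁ * ξ v₁) • LinearMap.id +
          LinearMap.smulRight (ξ : V →ₗ[ℝ] ℝ)
            (-(p' * ξ v₁ + p ^ 2 * ξ v₁) • u₁ +
              (p' * g u₁ v₁ - r' * h y.2 u₂ v₂ + r * q * h y.2 u₂ v₂ + p ^ 2 * g u₁ v₁) • A) +
          LinearMap.smulRight (g.flip v₁ : V →ₗ[ℝ] ℝ)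
            ((p ^ 2 * ξ A) • u₁ - ((p' + p ^ 2) * ξ u₁) • A) := by
    ext w
    simp only [curvatureEndo, LinearMap.comp_apply, LinearMap.coe_mk, AddHom.coe_mk,
      LinearMap.inl_apply, LinearMap.fst_apply, hC, hD]
    simp [hgA, hgs u₁ w]
    module
  have hW : LinearMap.snd ℝ V W ∘ₗ
        curvatureEndo (conformalWarpedForm g ξ φ f h) y (u₁, u₂) (v₁, v₂) ∘ₗ
        LinearMap.inr ℝ V W = curvatureEndo h y.2 u₂ v₂ +
          (-(q' * ξ u₁ * ξ v₁) + q * (-p * (2 * ξ u₁ * ξ v₁ - g u₁ v₁ * ξ A) -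
            r * h y.2 u₂ v₂ * ξ A) - q ^ 2 * ξ u₁ * ξ v₁) • LinearMap.id +
          LinearMap.smulRight ((h y.2).flip v₂ : W →ₗ[ℝ] ℝ) ((q * r * ξ A) • u₂) := by
    ext w
    simp only [curvatureEndo, LinearMap.comp_apply, LinearMap.coe_mk, AddHom.coe_mk,
      LinearMap.inr_apply, LinearMap.snd_apply, hC, hD]
    simp
    rw [hcs w u₂]
    module
  rw [hV, hW]
  simp only [map_add, map_smul, LinearMap.trace_id, LinearMap.trace_smulRight, smul_eq_mul,
    ricciInCoordinates]
  simp [hA]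
  ring

/-- The Einstein tensor equation for `φ(ξ)⁻² g + f(ξ)² h` with `h` Einstein, decomposed along
`ξ ⊗ ξ`, `g` and `h`; the three coefficients are multiples of the three differential equations. -/
theorem ricciInCoordinates_conformalWarpedForm_sub (hφ : ContDiff ℝ ∞ φ) (hf : ContDiff ℝ ∞ f)
    (hφ0 : ∀ t, φ t ≠ 0) (hfpos : ∀ t, 0 < f t)
    (hgs : ∀ u v, g u v = g v u) (hg : ∀ u, (∀ w, g u w = 0) → u = 0)
    {A : V} (hA : ∀ w, g A w = ξ w) {y : V × W} (hh : ∀ᶠ z in nhds y.2, ContDiffAt ℝ ∞ h z)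
    (hs : ∀ᶠ z in nhds y.2, ∀ u v, h z u v = h z v u)
    (hn : ∀ᶠ z in nhds y.2, ∀ u, (∀ w, h z u w = 0) → u = 0) {lamF : ℝ}
    (hE : ∀ u v, ricciInCoordinates h y.2 u v = lamF * h y.2 u v) (lam : ℝ) (u v : V × W) :
    ricciInCoordinates (conformalWarpedForm g ξ φ f h) y u v -
        lam * conformalWarpedForm g ξ φ f h y u v =
      (((Module.finrank ℝ V : ℝ) - 2) * f (ξ y.1) * deriv (deriv φ) (ξ y.1)
          - Module.finrank ℝ W * φ (ξ y.1) * deriv (deriv f) (ξ y.1)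
          - 2 * Module.finrank ℝ W * deriv φ (ξ y.1) * deriv f (ξ y.1)) /
          (f (ξ y.1) * φ (ξ y.1)) * (ξ u.1 * ξ v.1) +
      (ξ A * (f (ξ y.1) * φ (ξ y.1) * deriv (deriv φ) (ξ y.1)
          - ((Module.finrank ℝ V : ℝ) - 1) * f (ξ y.1) * deriv φ (ξ y.1) ^ 2
          + Module.finrank ℝ W * φ (ξ y.1) * deriv φ (ξ y.1) * deriv f (ξ y.1))
          - lam * f (ξ y.1)) / (f (ξ y.1) * φ (ξ y.1) ^ 2) * g u.1 v.1 +
      (ξ A * (-(f (ξ y.1) * φ (ξ y.1) ^ 2 * deriv (deriv f) (ξ y.1))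
          + ((Module.finrank ℝ V : ℝ) - 2) * f (ξ y.1) * φ (ξ y.1) * deriv φ (ξ y.1) *
            deriv f (ξ y.1)
          - ((Module.finrank ℝ W : ℝ) - 1) * φ (ξ y.1) ^ 2 * deriv f (ξ y.1) ^ 2)
          - (lam * f (ξ y.1) ^ 2 - lamF)) * h y.2 u.2 v.2 := by
  have dφ := ((hφ.differentiable (by simp)) (ξ y.1)).hasDerivAt
  have df := ((hf.differentiable (by simp)) (ξ y.1)).hasDerivAt
  have dφ' := (((contDiff_infty_iff_deriv.mp hφ).2.differentiable (by simp)) (ξ y.1)).hasDerivAt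
  have df' := (((contDiff_infty_iff_deriv.mp hf).2.differentiable (by simp)) (ξ y.1)).hasDerivAt
  have hφt := hφ0 (ξ y.1)
  have hft := (hfpos (ξ y.1)).ne'
  have dr : HasDerivAt (fun t => φ t ^ 2 * f t * deriv f t) _ _ := ((dφ.pow 2).mul df).mul df'
  rw [ricciInCoordinates_conformalWarpedForm hφ hf hφ0 hfpos hgs hg hA hh hs hn
    rfl rfl rfl (dφ'.div dφ hφt) (df'.div df hft) dr, hE, conformalWarpedForm_apply]
  simp only [Pi.pow_apply, Pi.mul_apply]
  push_cast
  field_simp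
  ring

end WarpedRicci

/-! ### Coordinate expressions of semi-Riemannian metrics -/

section Charts

variable {E : Type*} [NormedAddCommGroup E] [NormedSpace ℝ E]
  {H : Type*} [TopologicalSpace H] {I : ModelWithCorners ℝ E H}
  {M : Type*} [TopologicalSpace M] [ChartedSpace H M] [I.Boundaryless] [IsManifold I ∞ M]

/-- The derivative of the inverse of a chart is injective, having the derivative of the chart as a
left inverse. -/
theorem injective_mfderiv_extend_symm {e : OpenPartialHomeomorph M H} (he : e ∈ atlas H M) {y : E}
    (hy : y ∈ (e.extend I).target) :
    Function.Injective (mfderiv 𝓘(ℝ, E) I (e.extend I).symm y) := by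
  have hx : (e.extend I).symm y ∈ e.source := by
    have := (e.extend I).map_target hy
    rwa [e.extend_source] at this
  have h1 : MDifferentiableAt I 𝓘(ℝ, E) (e.extend I) ((e.extend I).symm y) :=
    (e.contMDiffAt_extend (n := ∞) (IsManifold.subset_maximalAtlas he) hx).mdifferentiableAt
      (by simp)
  have h2 := mdifferentiableAt_extend_symm (I := I) he hy
  have h3 := mfderiv_comp y h1 h2
  have h4 : (e.extend I) ∘ (e.extend I).symm =ᶠ[nhds y] id := by
    filter_upwards [e.isOpen_extend_target.mem_nhds hy] with z hz
    exact (e.extend I).right_inv hz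
  rw [h4.mfderiv_eq, mfderiv_id] at h3
  intro u v huv
  have h5 := fun w => congrArg (fun L => L w) h3
  exact (h5 u).trans ((congrArg (mfderiv I 𝓘(ℝ, E) (e.extend I) ((e.extend I).symm y))
    huv).trans (h5 v).symm)

variable [FiniteDimensional ℝ E] (gM : SemiRiemannianMetric I M)

theorem SemiRiemannianMetric.inChart_symm (e : OpenPartialHomeomorph M H) (y u v : E) :
    inChart I gM.val e y u v = inChart I gM.val e y v u :=
  gM.symm ((e.extend I).symm y) (mfderiv 𝓘(ℝ, E) I (e.extend I).symm y u)
    (mfderiv 𝓘(ℝ, E) I (e.extend I).symm y v)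

theorem SemiRiemannianMetric.inChart_nondegenerate {e : OpenPartialHomeomorph M H}
    (he : e ∈ atlas H M) {y : E} (hy : y ∈ (e.extend I).target) (u : E)
    (hu : ∀ v, inChart I gM.val e y u v = 0) : u = 0 := by
  have hinj := injective_mfderiv_extend_symm (I := I) he hy
  let D : E →L[ℝ] E := mfderiv 𝓘(ℝ, E) I (e.extend I).symm y
  have hsurj : Function.Surjective D :=
    (LinearMap.injective_iff_surjective (f := (D : E →ₗ[ℝ] E))).mp hinj
  have h0 : D u = 0 := gM.nondegenerate _ _ fun v => by
    obtain ⟨w, rfl⟩ := hsurj v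
    exact hu w
  exact hinj (h0.trans (map_zero D).symm)

theorem SemiRiemannianMetric.contDiffAt_inChart {e : OpenPartialHomeomorph M H}
    (he : e ∈ atlas H M) {y : E} (hy : y ∈ (e.extend I).target) :
    ContDiffAt ℝ ∞ (inChart I gM.val e) y :=
  (gM.smooth e he).contDiffAt (e.isOpen_extend_target.mem_nhds hy)

end Charts

/-! ### Warped products over a conformally pseudo-Euclidean base -/

section PseudoEuclideanBase

variable {n m : ℕ} {ε : Fin n → ℝ} {α : Fin n → ℝ}

theorem pseudoEuclideanForm_nondegenerate (hε : ∀ i, ε i = 1 ∨ ε i = -1)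
    (u : EuclideanSpace ℝ (Fin n)) (hu : ∀ v, pseudoEuclideanForm ε u v = 0) : u = 0 :=
  (conformalMetric ε hε (fun _ => 1) contDiff_const fun _ => one_ne_zero).nondegenerate 0 u
    fun v => mul_eq_zero_of_right (1 / (1 : ℝ) ^ 2) (hu v)

theorem pseudoEuclideanForm_gradient_xiForm (hε : ∀ i, ε i = 1 ∨ ε i = -1)
    (w : EuclideanSpace ℝ (Fin n)) :
    pseudoEuclideanForm ε (WithLp.toLp 2 fun i => ε i * α i) w = xiForm α w := by
  rw [pseudoEuclideanForm_apply, xiForm_apply]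
  refine Finset.sum_congr rfl fun i _ => ?_
  rcases hε i with h | h <;> simp [h]

theorem xiForm_gradient_xiForm :
    xiForm α (WithLp.toLp 2 fun i => ε i * α i) = ∑ i, ε i * α i ^ 2 := by
  rw [xiForm_apply]
  exact Finset.sum_congr rfl fun i _ => by simp only; ring

theorem xiForm_surjective (hα : α ≠ 0) : Function.Surjective (xiForm α) := by
  obtain ⟨i, hi⟩ := Function.ne_iff.mp hα
  refine LinearMap.surjective (f := (xiForm α : EuclideanSpace ℝ (Fin n) →ₗ[ℝ] ℝ)) fun h0 => hi ?_
  have := LinearMap.congr_fun h0 (EuclideanSpace.single i 1)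
  simpa [xiForm_apply] using this

/-- In dimension at least two, the square of a non-zero linear form and a nondegenerate bilinear
form are linearly independent: the kernel of the linear form contains a non-zero vector, which
the bilinear form pairs nontrivially with some vector. -/
theorem eq_zero_of_forall_mul_add_mul_eq_zero {V : Type*} [NormedAddCommGroup V] [NormedSpace ℝ V]
    [FiniteDimensional ℝ V] (hV : 2 ≤ Module.finrank ℝ V) {b : V →L[ℝ] V →L[ℝ] ℝ}
    (hb : ∀ u, (∀ w, b u w = 0) → u = 0) {ξ : V →L[ℝ] ℝ} (hξ : Function.Surjective ξ) {c d : ℝ}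
    (hcd : ∀ u v, c * (ξ u * ξ v) + d * b u v = 0) : c = 0 ∧ d = 0 := by
  have hker : LinearMap.ker (ξ : V →ₗ[ℝ] ℝ) ≠ ⊥ :=
    LinearMap.ker_ne_bot_of_finrank_lt (by rw [Module.finrank_self]; omega)
  obtain ⟨u, hu, hu0⟩ := Submodule.exists_mem_ne_zero_of_ne_bot hker
  have hu : ξ u = 0 := hu
  have hd : d = 0 := by
    by_contra hd
    refine hu0 (hb u fun w => ?_)
    simpa [hu, hd] using hcd u w
  obtain ⟨x, hx⟩ := hξ 1
  refine ⟨?_, hd⟩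
  simpa [hx, hd] using hcd x x

variable {φ f : ℝ → ℝ}
  {F : Type*} [TopologicalSpace F] [ChartedSpace (EuclideanSpace ℝ (Fin m)) F]
  [IsManifold (𝓡 m) ∞ F]

/-- The metric of the warped product in the product of the identity chart with a chart of `F`. -/
theorem inChart_warpedProduct_conformalMetric (hε : ∀ i, ε i = 1 ∨ ε i = -1)
    (hφ : ContDiff ℝ ∞ φ) (hf : ContDiff ℝ ∞ f) (hφ0 : ∀ t, φ t ≠ 0) (hfpos : ∀ t, 0 < f t)
    (gF : SemiRiemannianMetric (𝓡 m) F)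
    {e : OpenPartialHomeomorph F (EuclideanSpace ℝ (Fin m))}
    (he : e ∈ atlas (EuclideanSpace ℝ (Fin m)) F)
    {y : EuclideanSpace ℝ (Fin n) × EuclideanSpace ℝ (Fin m)}
    (hy : y.2 ∈ (e.extend (𝓡 m)).target) :
    inChart ((𝓡 n).prod (𝓡 m)) (warpedProduct
        (conformalMetric ε hε (φ ∘ xiForm α) (hφ.comp (xiForm α).contDiff) fun x => hφ0 (xiForm α x))
        gF (f ∘ xiForm α) (hf.comp (xiForm α).contDiff).contMDiff
        fun x => hfpos (xiForm α x)).val ((OpenPartialHomeomorph.refl _).prod e) y =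
      conformalWarpedForm (pseudoEuclideanForm ε) (xiForm α) φ f (inChart (𝓡 m) gF.val e) y := by
  have h1 := inChart_warpedForm (I := 𝓡 n) (J := 𝓡 m)
    (conformalMetric ε hε (φ ∘ xiForm α) (hφ.comp (xiForm α).contDiff)
      fun x => hφ0 (xiForm α x)).val gF.val (f ∘ xiForm α)
    (e := OpenPartialHomeomorph.refl _) (by simp) he (y := y) (by simp) hy
  have h2 : inChart (𝓡 n) (conformalMetric ε hε (φ ∘ xiForm α) (hφ.comp (xiForm α).contDiff)
      fun x => hφ0 (xiForm α x)).val (OpenPartialHomeomorph.refl _) y.1 =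
      (1 / φ (xiForm α y.1) ^ 2) • pseudoEuclideanForm ε :=
    inChart_refl (fun x : EuclideanSpace ℝ (Fin n) =>
      (1 / φ (xiForm α x) ^ 2) • pseudoEuclideanForm ε) y.1
  rw [h2] at h1
  exact h1

/-- The Einstein condition for the warped product, tested in the product charts. -/
theorem isEinstein_warpedProduct_iff_forall (hε : ∀ i, ε i = 1 ∨ ε i = -1)
    (hφ : ContDiff ℝ ∞ φ) (hf : ContDiff ℝ ∞ f) (hφ0 : ∀ t, φ t ≠ 0) (hfpos : ∀ t, 0 < f t)
    (gF : SemiRiemannianMetric (𝓡 m) F) (lam : ℝ) :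
    (warpedProduct
        (conformalMetric ε hε (φ ∘ xiForm α) (hφ.comp (xiForm α).contDiff) fun x => hφ0 (xiForm α x))
        gF (f ∘ xiForm α) (hf.comp (xiForm α).contDiff).contMDiff
        fun x => hfpos (xiForm α x)).IsEinstein lam ↔
      ∀ e ∈ atlas (EuclideanSpace ℝ (Fin m)) F, ∀ x, ∀ z ∈ (e.extend (𝓡 m)).target, ∀ u v,
        ricciInCoordinates (conformalWarpedForm (pseudoEuclideanForm ε) (xiForm α) φ f
            (inChart (𝓡 m) gF.val e)) (x, z) u v =
          lam * conformalWarpedForm (pseudoEuclideanForm ε) (xiForm α) φ f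
            (inChart (𝓡 m) gF.val e) (x, z) u v := by
  have hchart := fun {e} (he : e ∈ atlas (EuclideanSpace ℝ (Fin m)) F)
    (y : EuclideanSpace ℝ (Fin n) × EuclideanSpace ℝ (Fin m)) hy =>
    inChart_warpedProduct_conformalMetric (α := α) hε hφ hf hφ0 hfpos gF he (y := y) hy
  have hric := fun {e} (he : e ∈ atlas (EuclideanSpace ℝ (Fin m)) F)
      (y : EuclideanSpace ℝ (Fin n) × EuclideanSpace ℝ (Fin m))
      (hy : y.2 ∈ (e.extend (𝓡 m)).target) =>
    ricciInCoordinates_congr (y := y) (by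
      filter_upwards [continuousAt_snd.eventually (e.isOpen_extend_target.mem_nhds hy)] with y' hy'
      exact hchart he y' hy')
  have htarget : ∀ e : OpenPartialHomeomorph F (EuclideanSpace ℝ (Fin m)),
      (((OpenPartialHomeomorph.refl (EuclideanSpace ℝ (Fin n))).prod e).extend
        ((𝓡 n).prod (𝓡 m))).target = Set.univ ×ˢ (e.extend (𝓡 m)).target := by
    intro e
    rw [OpenPartialHomeomorph.extend_prod]
    simp
  constructor
  · intro h e he x z hz u v
    have := h ((OpenPartialHomeomorph.refl _).prod e)
      ⟨OpenPartialHomeomorph.refl _, by simp, e, he, rfl⟩ (x, z)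
      (by rw [htarget]; exact ⟨trivial, hz⟩) u v
    rw [← hric he (x, z) hz, ← hchart he (x, z) hz]
    exact this
  · rintro h _ ⟨e₀, he₀, e, he, rfl⟩ y hy u v
    rw [chartedSpaceSelf_atlas] at he₀
    subst he₀
    rw [htarget] at hy
    have := h e he y.1 y.2 hy.2 u v
    rw [← hric he y hy.2, ← hchart he y hy.2] at this
    exact this

/-- For any non-zero `α`, isotropic or not, the warped product is Einstein if and only if the three
differential equations hold. -/
theorem isEinstein_warpedProduct_iff (hn : 2 ≤ n) (hm : 1 ≤ m)
    (hε : ∀ i, ε i = 1 ∨ ε i = -1) (hα : α ≠ 0)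
    (hφ : ContDiff ℝ ∞ φ) (hf : ContDiff ℝ ∞ f) (hφ0 : ∀ t, φ t ≠ 0) (hfpos : ∀ t, 0 < f t)
    [Nonempty F] (gF : SemiRiemannianMetric (𝓡 m) F) (lamF lam : ℝ) (hF : gF.IsEinstein lamF) :
    (warpedProduct
        (conformalMetric ε hε (φ ∘ xiForm α) (hφ.comp (xiForm α).contDiff) fun x => hφ0 (xiForm α x))
        gF (f ∘ xiForm α) (hf.comp (xiForm α).contDiff).contMDiff
        fun x => hfpos (xiForm α x)).IsEinstein lam ↔
      ∀ t : ℝ,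
        ((n : ℝ) - 2) * f t * deriv (deriv φ) t - m * φ t * deriv (deriv f) t
            - 2 * m * deriv φ t * deriv f t = 0 ∧
        (∑ k, ε k * α k ^ 2) * (f t * φ t * deriv (deriv φ) t
            - ((n : ℝ) - 1) * f t * deriv φ t ^ 2 + m * φ t * deriv φ t * deriv f t)
          = lam * f t ∧
        (∑ k, ε k * α k ^ 2) * (-(f t * φ t ^ 2 * deriv (deriv f) t)
            + ((n : ℝ) - 2) * f t * φ t * deriv φ t * deriv f t
            - ((m : ℝ) - 1) * φ t ^ 2 * deriv f t ^ 2)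
          = lam * f t ^ 2 - lamF := by
  rw [isEinstein_warpedProduct_iff_forall hε hφ hf hφ0 hfpos]
  set S := ∑ k, ε k * α k ^ 2 with hS
  have hgs : ∀ u v, pseudoEuclideanForm ε u v = pseudoEuclideanForm ε v u := fun u v => by
    simp only [pseudoEuclideanForm_apply, mul_right_comm]
  have hg := pseudoEuclideanForm_nondegenerate hε
  have hric := fun {e} (he : e ∈ atlas (EuclideanSpace ℝ (Fin m)) F) x {z}
      (hz : z ∈ (e.extend (𝓡 m)).target) =>
    have htar : ∀ᶠ z' in nhds z, z' ∈ (e.extend (𝓡 m)).target :=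
      e.isOpen_extend_target.mem_nhds hz
    ricciInCoordinates_conformalWarpedForm_sub (y := (x, z)) hφ hf hφ0 hfpos hgs hg
      (pseudoEuclideanForm_gradient_xiForm (α := α) hε)
      (htar.mono fun z' hz' => gF.contDiffAt_inChart he hz')
      (Filter.Eventually.of_forall fun z' => gF.inChart_symm e z')
      (htar.mono fun z' hz' => gF.inChart_nondegenerate he hz')
      (hF e he z hz) lam
  simp only [finrank_euclideanSpace, Fintype.card_fin, xiForm_gradient_xiForm, ← hS] at hric
  have hξ := xiForm_surjective hα
  constructor
  · intro h t
    -- every `t` is a value of `ξ`, so a point of the base and a chart of `F` give the equations at `t`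
    obtain ⟨x, rfl⟩ := hξ t
    obtain ⟨b⟩ := ‹Nonempty F›
    have he := chart_mem_atlas (EuclideanSpace ℝ (Fin m)) b
    have hz : (chartAt (EuclideanSpace ℝ (Fin m)) b).extend (𝓡 m) b ∈
        ((chartAt (EuclideanSpace ℝ (Fin m)) b).extend (𝓡 m)).target :=
      mem_extChartAt_target (I := 𝓡 m) b
    have key := fun u v => (hric he x hz u v).symm.trans (sub_eq_zero.mpr (h _ he x _ hz u v))
    have hφt := hφ0 (xiForm α x)
    have hft := (hfpos (xiForm α x)).ne'
    -- horizontal vectors isolate the coefficients of `ξ ⊗ ξ` and `g`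
    have h12 := eq_zero_of_forall_mul_add_mul_eq_zero (by simpa using hn) hg hξ
      fun u v => by simpa using key (u, 0) (v, 0)
    have : Nonempty (Fin m) := ⟨⟨0, hm⟩⟩
    obtain ⟨u, hu⟩ := exists_ne (0 : EuclideanSpace ℝ (Fin m))
    refine ⟨?_, ?_, ?_⟩
    · simpa [hφt, hft] using h12.1
    · simpa [hφt, hft, sub_eq_zero] using h12.2
    · -- vertical vectors isolate the coefficient of `h`
      by_contra hne
      refine hu (gF.inChart_nondegenerate he hz u fun v => ?_)
      exact (mul_eq_zero.mp (by simpa using key (0, u) (0, v))).resolve_left (sub_ne_zero.mpr hne)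
  · intro h e he x z hz u v
    obtain ⟨h1, h2, h3⟩ := h (xiForm α x)
    rw [← sub_eq_zero, hric he x hz u v, h1, h2, h3]
    simp

end PseudoEuclideanBase

theorem theorem1p2 (n m : ℕ) (hn : 3 ≤ n) (hm : 1 ≤ m)
    (ε : Fin n → ℝ) (hε : ∀ i, ε i = 1 ∨ ε i = -1) (α : Fin n → ℝ)
    (φ f : ℝ → ℝ) (hφ : ContDiff ℝ ∞ φ) (hf : ContDiff ℝ ∞ f)
    (hφ0 : ∀ t, φ t ≠ 0) (hfpos : ∀ t, 0 < f t)
    {F : Type*} [TopologicalSpace F] [ChartedSpace (EuclideanSpace ℝ (Fin m)) F]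
    [IsManifold (𝓡 m) ∞ F] [Nonempty F]
    (gF : SemiRiemannianMetric (𝓡 m) F) (lamF lam : ℝ) (hF : gF.IsEinstein lamF) :
    (∑ i, ε i * α i ^ 2 ≠ 0 →
      ((warpedProduct
          (conformalMetric ε hε (φ ∘ xiForm α) (hφ.comp (xiForm α).contDiff) fun x => hφ0 (xiForm α x))
          gF (f ∘ xiForm α) (hf.comp (xiForm α).contDiff).contMDiff
          fun x => hfpos (xiForm α x)).IsEinstein lam ↔
        ∀ t : ℝ,
          ((n : ℝ) - 2) * f t * deriv (deriv φ) t - m * φ t * deriv (deriv f) t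
              - 2 * m * deriv φ t * deriv f t = 0 ∧
          (∑ k, ε k * α k ^ 2) * (f t * φ t * deriv (deriv φ) t
              - ((n : ℝ) - 1) * f t * deriv φ t ^ 2 + m * φ t * deriv φ t * deriv f t)
            = lam * f t ∧
          (∑ k, ε k * α k ^ 2) * (-(f t * φ t ^ 2 * deriv (deriv f) t)
              + ((n : ℝ) - 2) * f t * φ t * deriv φ t * deriv f t
              - ((m : ℝ) - 1) * φ t ^ 2 * deriv f t ^ 2)
            = lam * f t ^ 2 - lamF)) ∧
    (α ≠ 0 → ∑ i, ε i * α i ^ 2 = 0 →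
      ((warpedProduct
          (conformalMetric ε hε (φ ∘ xiForm α) (hφ.comp (xiForm α).contDiff) fun x => hφ0 (xiForm α x))
          gF (f ∘ xiForm α) (hf.comp (xiForm α).contDiff).contMDiff
          fun x => hfpos (xiForm α x)).IsEinstein lam ↔
        (∀ t : ℝ,
          ((n : ℝ) - 2) * f t * deriv (deriv φ) t - m * φ t * deriv (deriv f) t
              - 2 * m * deriv φ t * deriv f t = 0) ∧
        lam = 0 ∧ lamF = 0)) := by

  refine ⟨fun hS => ?_, fun hα hS => ?_⟩
  · have hα : α ≠ 0 := by
      rintro rfl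
      simp at hS
    exact isEinstein_warpedProduct_iff (by omega) hm hε hα hφ hf hφ0 hfpos gF lamF lam hF
  · rw [isEinstein_warpedProduct_iff (by omega) hm hε hα hφ hf hφ0 hfpos gF lamF lam hF, hS]
    constructor
    · intro h
      have hlam : lam = 0 := by simpa [(hfpos 0).ne'] using (h 0).2.1
      exact ⟨fun t => (h t).1, hlam, by simpa [hlam] using (h 0).2.2⟩
    · rintro ⟨h, rfl, rfl⟩ t
      exact ⟨h t, by ring, by ring⟩
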